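/- For integers $m,n,k,r$ put $$\Gamma(m,n,k,r):=\frac{m^2}{\big(\sqrt{(k+1)(m-n+r)}-\sqrt{(n-r)(m-k-1)}\big)^2}.$$ For a real matrix $A$, let $\sigma_{\min}(A)$ be the smallest of its singular values, where a $p\times q$ matrix has $\min(p,q)$ singular values, counted with multiplicity and possibly zero; let $A^{\dagger}$ be its Moore–Penrose pseudoinverse and $\|A\|_F$ its Frobenius norm. For a set $\mathcal S$ of column indices, $Y_{\mathcal S}$ denotes the submatrix of $Y$ formed by the columns indexed by $\mathcal S$. **Theorem 3.1.** Let $n\ge 1$, $m,\ell\ge 0$ be integers and let $Y\in\mathbb R^{n\times(m+\ell)}$ satisfy $YY^T=I$. Let $\mathcal S_M\subseteq\{1,\dots,m+\ell\}$ with $|\mathcal S_M|=\ell$, let $M:=Y_{\mathcal S_M}\in\mathbb R^{n\times\ell}$, and let $r:=\operatorname{rank}(M)$. Then for every integer $k$ with $n-r\le k\le m-1$ there exists a set $\mathcal S_0\subseteq\{1,\dots,m+\ell\}\setminus\mathcal S_M$ with $|\mathcal S_0|=k$ such that $$\sigma_{\min}\big([M\ \ Y_{\mathcal S_0}]\big)^2\;\ge\;\Gamma(m,n,k,r)^{-1}\cdot\frac{m-n+r}{m-n+\|M^{\dagger}\|_F^2}.$$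 -/

import Mathlib

open scoped Matrix Matrix.Norms.Frobenius

namespace SubsetSelection

/-- `Γ(m, n, k, r) = m² / (√((k+1)(m-n+r)) - √((n-r)(m-k-1)))²`, for integers `m, n, k, r`. -/
noncomputable def Gam (m n k r : ℤ) : ℝ :=
  (m : ℝ) ^ 2 /
    (Real.sqrt (((k : ℝ) + 1) * ((m : ℝ) - n + r))
      - Real.sqrt (((n : ℝ) - r) * ((m : ℝ) - k - 1))) ^ 2

section Matrices

variable {p q : Type*} [Fintype p] [Fintype q] [DecidableEq q]

/-- The submatrix `Y_S` formed by the columns of `Y` indexed by `S`. -/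
def cols (Y : Matrix p q ℝ) (S : Finset q) : Matrix p {j // j ∈ S} ℝ :=
  Y.submatrix id Subtype.val

/-- The smallest singular value `σ_min(A)`: the last one among the `min(|p|, |q|)` singular values
of a `p × q` matrix `A`, listed in descending order with multiplicity (zero allowed). Mathlib's list
`LinearMap.singularValues` starts at index `0`. -/
noncomputable def sigmaMin (A : Matrix p q ℝ) : ℝ :=
  (Matrix.toEuclideanLin A).singularValues (min (Fintype.card p) (Fintype.card q) - 1)

/-- The Moore-Penrose pseudoinverse `A† = (AᵀA)† Aᵀ`. Here the pseudoinverse of the symmetric matrix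
`AᵀA = U diag(λ) Uᵀ` is `U diag(λ⁻¹) Uᵀ`, with `0⁻¹ = 0`. If `A = U Σ Vᵀ` is a thin singular value
decomposition, this is `V Σ⁻¹ Uᵀ`; it is characterized by the Penrose equations, see
`isMoorePenrose_iff`. -/
noncomputable def pinv (A : Matrix p q ℝ) : Matrix q p ℝ :=
  ((Matrix.isHermitian_conjTranspose_mul_self A).eigenvectorUnitary : Matrix q q ℝ) *
    Matrix.diagonal (fun i => ((Matrix.isHermitian_conjTranspose_mul_self A).eigenvalues i)⁻¹) *
    ((Matrix.isHermitian_conjTranspose_mul_self A).eigenvectorUnitary : Matrix q q ℝ)ᵀ * Aᵀ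

/-- The four Penrose equations. -/
structure IsMoorePenrose (A : Matrix p q ℝ) (X : Matrix q p ℝ) : Prop where
  mul_mul_left : A * X * A = A
  mul_mul_right : X * A * X = X
  symm_left : (A * X)ᵀ = A * X
  symm_right : (X * A)ᵀ = X * A

theorem isMoorePenrose_pinv (A : Matrix p q ℝ) : IsMoorePenrose A (pinv A) := by
  have hA : (Aᴴ * A).IsHermitian := Matrix.isHermitian_conjTranspose_mul_self A
  obtain ⟨U, hU⟩ : ∃ U : Matrix q q ℝ, U = (hA.eigenvectorUnitary : Matrix q q ℝ) := ⟨_, rfl⟩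
  obtain ⟨d, hd⟩ : ∃ d : q → ℝ, d = hA.eigenvalues := ⟨_, rfl⟩
  have hUU : Uᵀ * U = 1 := by
    have h := Matrix.UnitaryGroup.star_mul_self hA.eigenvectorUnitary
    rw [← hU, Matrix.star_eq_conjTranspose, Matrix.conjTranspose_eq_transpose_of_trivial] at h
    exact h
  have hH : Aᵀ * A = U * Matrix.diagonal d * Uᵀ := by
    have h := hA.spectral_theorem
    rw [Unitary.conjStarAlgAut_apply, ← hU, Matrix.star_eq_conjTranspose,
      Matrix.conjTranspose_eq_transpose_of_trivial U] at h
    rw [← Matrix.conjTranspose_eq_transpose_of_trivial A, h, hd]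
    rfl
  obtain ⟨P, hP⟩ : ∃ P : Matrix q q ℝ, P = U * Matrix.diagonal (fun i => (d i)⁻¹) * Uᵀ := ⟨_, rfl⟩
  have hX : pinv A = P * Aᵀ := by
    rw [hP, hU, hd]
    rfl
  have hPt : Pᵀ = P := by
    rw [hP]
    simp [Matrix.transpose_mul, Matrix.mul_assoc]
  have key : ∀ a b : q → ℝ, (U * Matrix.diagonal a * Uᵀ) * (U * Matrix.diagonal b * Uᵀ)
      = U * Matrix.diagonal (fun i => a i * b i) * Uᵀ := by
    intro a b
    calc (U * Matrix.diagonal a * Uᵀ) * (U * Matrix.diagonal b * Uᵀ)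
        = U * Matrix.diagonal a * (Uᵀ * U) * Matrix.diagonal b * Uᵀ := by
          simp only [Matrix.mul_assoc]
      _ = _ := by rw [hUU, Matrix.mul_one, Matrix.mul_assoc U, Matrix.diagonal_mul_diagonal]
  have hPH : P * (Aᵀ * A) = U * Matrix.diagonal (fun i => (d i)⁻¹ * d i) * Uᵀ := by
    rw [hP, hH, key]
  have hHPH : (Aᵀ * A) * (P * (Aᵀ * A)) = Aᵀ * A := by
    rw [hPH, hH, key]
    congr 3
    funext i
    by_cases h : d i = 0 <;> simp [h]
  have hPHP : P * (Aᵀ * A) * P = P := by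
    rw [hPH, hP, key]
    congr 3
    funext i
    by_cases h : d i = 0 <;> simp [h]
  have hPHt : (P * (Aᵀ * A))ᵀ = P * (Aᵀ * A) := by
    rw [hPH]
    simp [Matrix.transpose_mul, Matrix.mul_assoc]
  have hAPH : A * (P * (Aᵀ * A)) = A := by
    have h0 : (A * (P * (Aᵀ * A)) - A)ᴴ * (A * (P * (Aᵀ * A)) - A) = 0 := by
      have h1 : Aᵀ * (A * (P * (Aᵀ * A)) - A) = 0 := by
        rw [Matrix.mul_sub, ← Matrix.mul_assoc Aᵀ A, hHPH, sub_self]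
      have h2 : A * (P * (Aᵀ * A)) - A = A * (P * (Aᵀ * A) - 1) := by
        rw [Matrix.mul_sub, Matrix.mul_one]
      rw [Matrix.conjTranspose_eq_transpose_of_trivial]
      nth_rewrite 1 [h2]
      rw [Matrix.transpose_mul, Matrix.mul_assoc, h1, Matrix.mul_zero]
    exact sub_eq_zero.mp (Matrix.conjTranspose_mul_self_eq_zero.mp h0)
  rw [hX]
  refine ⟨?_, ?_, ?_, ?_⟩
  · calc A * (P * Aᵀ) * A = A * (P * (Aᵀ * A)) := by simp only [Matrix.mul_assoc]
      _ = A := hAPH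
  · calc P * Aᵀ * A * (P * Aᵀ) = P * (Aᵀ * A) * P * Aᵀ := by simp only [Matrix.mul_assoc]
      _ = P * Aᵀ := by rw [hPHP]
  · simp [Matrix.transpose_mul, hPt, Matrix.mul_assoc]
  · rw [Matrix.mul_assoc, hPHt]

theorem isMoorePenrose_iff (A : Matrix p q ℝ) (X : Matrix q p ℝ) :
    IsMoorePenrose A X ↔ X = pinv A := by
  refine ⟨fun h => ?_, fun h => h ▸ isMoorePenrose_pinv A⟩
  have g := isMoorePenrose_pinv A
  obtain ⟨Z, hZ⟩ : ∃ Z : Matrix q p ℝ, Z = pinv A := ⟨_, rfl⟩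
  rw [← hZ] at g ⊢
  have h1 : A * X = A * Z := by
    calc A * X = (A * X)ᵀ := h.symm_left.symm
      _ = (A * Z * A * X)ᵀ := by rw [g.mul_mul_left]
      _ = (A * X)ᵀ * (A * Z)ᵀ := by rw [← Matrix.transpose_mul, ← Matrix.mul_assoc]
      _ = A * X * (A * Z) := by rw [h.symm_left, g.symm_left]
      _ = A * X * A * Z := by rw [← Matrix.mul_assoc]
      _ = A * Z := by rw [h.mul_mul_left]
  have h2 : X * A = Z * A := by
    calc X * A = (X * A)ᵀ := h.symm_right.symm
      _ = (X * (A * Z * A))ᵀ := by rw [g.mul_mul_left]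
      _ = (Z * A)ᵀ * (X * A)ᵀ := by rw [← Matrix.transpose_mul]; simp only [Matrix.mul_assoc]
      _ = Z * A * (X * A) := by rw [h.symm_right, g.symm_right]
      _ = Z * (A * X * A) := by simp only [Matrix.mul_assoc]
      _ = Z * A := by rw [h.mul_mul_left]
  calc X = X * A * X := h.mul_mul_right.symm
    _ = Z * (A * X) := by rw [h2, Matrix.mul_assoc]
    _ = Z * A * Z := by rw [h1, Matrix.mul_assoc]
    _ = Z := g.mul_mul_right

end Matrices

end SubsetSelection

namespace SubsetSelection

open Filter Topology

/-! ### Resolvents and orthogonal diagonalization -/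

section Spectral

variable {ι : Type*} [Fintype ι] [DecidableEq ι]

/-! Let `N` consist of the `m` columns outside `SM`, so that `M * Mᵀ + N * Nᵀ = 1`. If the columns
not selected form `N'`, the Gram matrix of the selection is `1 - N' * N'ᵀ`. It is bounded below by
`c` once the principal submatrix `1 - N'ᵀ * N'` of `C = 1 - Nᵀ * N` is. The task is thus to delete
`k` indices from `C` so that the bottom of its spectrum rises.

This is a barrier argument. Put a barrier at `-t` below the spectrum of `C`, with potential `φ = tr
(C + t)⁻¹`, and let `δ⁻¹` be an upper bound for `φ`. Some index can be deleted while the barrier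
rises by `δ` and the potential stays at most `δ⁻¹` (`exists_delete`). After `k` deletions one more
rise by `δ` is free, which gives the bound `-t + (k + 1) δ`.

The potential is controlled by two numbers (`card_and_sum_inv_eigenvalues`): `C` has `n - r` zero
eigenvalues, and its nonzero eigenvalues have reciprocal sum `m - n + ‖M†‖²`. Replacing the latter
by their harmonic mean `h` only increases the potential (`sum_inv_add_le`). Optimizing over `t` then
produces `Γ⁻¹ * h` (`optimize_barrier`). -/

theorem exists_orthogonal_diagonalization {C : Matrix ι ι ℝ} (hC : C.IsHermitian) :
    ∃ U : Matrix ι ι ℝ, Uᵀ * U = 1 ∧ U * Uᵀ = 1 ∧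
      C = U * Matrix.diagonal hC.eigenvalues * Uᵀ := by
  refine ⟨hC.eigenvectorUnitary, ?_, ?_, ?_⟩
  · have h := Matrix.UnitaryGroup.star_mul_self hC.eigenvectorUnitary
    rwa [Matrix.star_eq_conjTranspose, Matrix.conjTranspose_eq_transpose_of_trivial] at h
  · have h := Unitary.mul_star_self_of_mem hC.eigenvectorUnitary.2
    rwa [Matrix.star_eq_conjTranspose, Matrix.conjTranspose_eq_transpose_of_trivial] at h
  · have h := hC.spectral_theorem
    rw [Unitary.conjStarAlgAut_apply, Matrix.star_eq_conjTranspose,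
      Matrix.conjTranspose_eq_transpose_of_trivial] at h
    exact h

theorem conj_diagonal_mul {U : Matrix ι ι ℝ} (hU : Uᵀ * U = 1) (a b : ι → ℝ) :
    (U * Matrix.diagonal a * Uᵀ) * (U * Matrix.diagonal b * Uᵀ)
      = U * Matrix.diagonal (fun i => a i * b i) * Uᵀ := by
  calc _ = U * Matrix.diagonal a * (Uᵀ * U) * Matrix.diagonal b * Uᵀ := by
        simp only [Matrix.mul_assoc]
    _ = _ := by rw [hU, Matrix.mul_one, Matrix.mul_assoc U, Matrix.diagonal_mul_diagonal]

theorem trace_conj_diagonal {U : Matrix ι ι ℝ} (hU : Uᵀ * U = 1) (a : ι → ℝ) :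
    (U * Matrix.diagonal a * Uᵀ).trace = ∑ i, a i := by
  rw [Matrix.trace_mul_comm, ← Matrix.mul_assoc, hU, Matrix.one_mul, Matrix.trace_diagonal]

theorem add_smul_one_eq_conj {C U : Matrix ι ι ℝ} {c : ι → ℝ} (hU : U * Uᵀ = 1)
    (hC : C = U * Matrix.diagonal c * Uᵀ) (s : ℝ) :
    C + s • (1 : Matrix ι ι ℝ) = U * Matrix.diagonal (fun i => c i + s) * Uᵀ := by
  have h : Matrix.diagonal (fun i => c i + s) = Matrix.diagonal c + s • (1 : Matrix ι ι ℝ) := by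
    rw [Matrix.smul_one_eq_diagonal, Matrix.diagonal_add]
  rw [h, Matrix.mul_add, Matrix.add_mul, ← hC, Matrix.mul_smul, Matrix.mul_one, Matrix.smul_mul, hU]

theorem inv_add_smul_one_eq_conj {C U : Matrix ι ι ℝ} {c : ι → ℝ} (hU' : Uᵀ * U = 1)
    (hU : U * Uᵀ = 1) (hC : C = U * Matrix.diagonal c * Uᵀ) {s : ℝ} (hs : ∀ i, c i + s ≠ 0) :
    (C + s • (1 : Matrix ι ι ℝ))⁻¹ = U * Matrix.diagonal (fun i => (c i + s)⁻¹) * Uᵀ := by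
  apply Matrix.inv_eq_right_inv
  rw [add_smul_one_eq_conj hU hC, conj_diagonal_mul hU']
  simp [hs, hU]

theorem trace_inv_add_smul_one {C : Matrix ι ι ℝ} (hC : C.IsHermitian) {s : ℝ}
    (hs : ∀ i, hC.eigenvalues i + s ≠ 0) :
    ((C + s • (1 : Matrix ι ι ℝ))⁻¹).trace = ∑ i, (hC.eigenvalues i + s)⁻¹ := by
  obtain ⟨U, hU', hU, h⟩ := exists_orthogonal_diagonalization hC
  rw [inv_add_smul_one_eq_conj hU' hU h hs, trace_conj_diagonal hU']

theorem trace_inv_mul_inv_add_smul_one {C : Matrix ι ι ℝ} (hC : C.IsHermitian) {s : ℝ}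
    (hs : ∀ i, hC.eigenvalues i + s ≠ 0) :
    ((C + s • (1 : Matrix ι ι ℝ))⁻¹ * (C + s • (1 : Matrix ι ι ℝ))⁻¹).trace
      = ∑ i, (hC.eigenvalues i + s)⁻¹ ^ 2 := by
  obtain ⟨U, hU', hU, h⟩ := exists_orthogonal_diagonalization hC
  rw [inv_add_smul_one_eq_conj hU' hU h hs, conj_diagonal_mul hU', trace_conj_diagonal hU']
  simp only [sq]

theorem posSemidef_add_smul_one {C : Matrix ι ι ℝ} (hC : C.IsHermitian) {s : ℝ}
    (hs : ∀ i, 0 ≤ hC.eigenvalues i + s) : (C + s • (1 : Matrix ι ι ℝ)).PosSemidef := by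
  obtain ⟨U, hU', hU, h⟩ := exists_orthogonal_diagonalization hC
  rw [add_smul_one_eq_conj hU h]
  have := (Matrix.PosSemidef.diagonal (d := fun i => hC.eigenvalues i + s)
    hs).mul_mul_conjTranspose_same U
  simpa using this

theorem posDef_add_smul_one {C : Matrix ι ι ℝ} (hC : C.IsHermitian) {s : ℝ}
    (hs : ∀ i, 0 < hC.eigenvalues i + s) : (C + s • (1 : Matrix ι ι ℝ)).PosDef := by
  obtain ⟨U, hU', hU, h⟩ := exists_orthogonal_diagonalization hC
  rw [add_smul_one_eq_conj hU h]
  have := (Matrix.PosDef.diagonal (d := fun i => hC.eigenvalues i + s)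
    hs).mul_mul_conjTranspose_same (B := U) (by
      intro x y hxy
      have := congrArg (fun z => Matrix.vecMul z Uᵀ) hxy
      simpa [Matrix.vecMul_vecMul, hU] using this)
  simpa using this

/-- The traces of the resolvents of `V * W` and `W * V` differ by the contribution of the
eigenvalue `0`. -/
theorem trace_inv_mul_comm {κ : Type*} [Fintype κ] [DecidableEq κ] (V : Matrix ι κ ℝ)
    (W : Matrix κ ι ℝ) {s : ℝ} (hs : s ≠ 0) (h₁ : IsUnit (V * W + s • (1 : Matrix ι ι ℝ)))
    (h₂ : IsUnit (W * V + s • (1 : Matrix κ κ ℝ))) :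
    ((V * W + s • (1 : Matrix ι ι ℝ))⁻¹).trace =
      ((Fintype.card ι : ℝ) - Fintype.card κ) / s
        + ((W * V + s • (1 : Matrix κ κ ℝ))⁻¹).trace := by
  obtain ⟨P, hP⟩ : ∃ P, P = (V * W + s • (1 : Matrix ι ι ℝ))⁻¹ := ⟨_, rfl⟩
  obtain ⟨Q, hQ⟩ : ∃ Q, Q = (W * V + s • (1 : Matrix κ κ ℝ))⁻¹ := ⟨_, rfl⟩
  have hP1 : P * (V * W + s • (1 : Matrix ι ι ℝ)) = 1 := by
    rw [hP]; exact Matrix.nonsing_inv_mul _ ((Matrix.isUnit_iff_isUnit_det _).mp h₁)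
  have hQ1 : (W * V + s • (1 : Matrix κ κ ℝ)) * Q = 1 := by
    rw [hQ]; exact Matrix.mul_nonsing_inv _ ((Matrix.isUnit_iff_isUnit_det _).mp h₂)
  -- Both resolvents intertwine through `V`. Hence the traces of `P * V * W` and `W * V * Q` agree,
  -- and only the sizes of the two identities differ.
  have hPV : P * V = V * Q := by
    calc P * V = P * V * ((W * V + s • (1 : Matrix κ κ ℝ)) * Q) := by rw [hQ1, Matrix.mul_one]
      _ = P * (V * W + s • (1 : Matrix ι ι ℝ)) * V * Q := by
        simp only [Matrix.mul_add, Matrix.add_mul, Matrix.mul_smul, Matrix.smul_mul,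
          Matrix.mul_one, Matrix.one_mul, Matrix.mul_assoc]
      _ = V * Q := by rw [hP1, Matrix.one_mul]
  have e1 : (P * V * W).trace + s * P.trace = Fintype.card ι := by
    have := congrArg Matrix.trace hP1
    rwa [Matrix.mul_add, Matrix.mul_smul, Matrix.mul_one, Matrix.trace_add, Matrix.trace_smul,
      Matrix.trace_one, smul_eq_mul, ← Matrix.mul_assoc] at this
  have e2 : (W * V * Q).trace + s * Q.trace = Fintype.card κ := by
    have := congrArg Matrix.trace hQ1
    rwa [Matrix.add_mul, Matrix.smul_mul, Matrix.one_mul, Matrix.trace_add, Matrix.trace_smul,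
      Matrix.trace_one, smul_eq_mul] at this
  rw [hPV, Matrix.trace_mul_comm, ← Matrix.mul_assoc] at e1
  rw [← hP, ← hQ]
  field_simp
  linarith

end Spectral

/-! ### Deleting rows and columns under a moving barrier -/

section Delete

/-- Chebyshev's sum inequality with weights `y`, for the oppositely ordered sequences `y` and `p /
y`. The hypothesis `h` is that ordering with denominators cleared. -/
theorem sum_mul_le_of_chebyshev {ι : Type*} [Fintype ι] (y p : ι → ℝ) (hp : ∑ i, p i ≤ 1)
    (h : ∀ i j, 0 ≤ (y j - y i) * (p i * y j - p j * y i)) :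
    (∑ i, y i) * ∑ i, y i * p i ≤ ∑ i, y i ^ 2 := by
  have h1 : 0 ≤ ∑ i, ∑ j, (y j - y i) * (p i * y j - p j * y i) :=
    Finset.sum_nonneg fun i _ => Finset.sum_nonneg fun j _ => h i j
  have h2 : ∑ i, ∑ j, (y j - y i) * (p i * y j - p j * y i) =
      2 * ((∑ i, p i) * ∑ i, y i ^ 2) - 2 * ((∑ i, y i) * ∑ i, y i * p i) := by
    have e : ∀ i j, (y j - y i) * (p i * y j - p j * y i) =
        p i * y j ^ 2 + y i ^ 2 * p j - y i * (y j * p j) - (y i * p i) * y j := by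
      intros; ring
    simp only [e, Finset.sum_sub_distrib, Finset.sum_add_distrib, ← Finset.mul_sum,
      ← Finset.sum_mul]
    ring
  have h3 : (∑ i, p i) * ∑ i, y i ^ 2 ≤ 1 * ∑ i, y i ^ 2 :=
    mul_le_mul_of_nonneg_right hp (Finset.sum_nonneg fun i _ => sq_nonneg _)
  linarith

/-- Shifting a barrier by `δ` raises the potential `∑ 1 / x i` by at most what differentiation of
the polynomial with roots `x i` makes up for. -/
theorem sq_sum_inv_sub_le {ι : Type*} [Fintype ι] {x : ι → ℝ} {δ : ℝ} (hδ : 0 < δ)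
    (hx : ∀ i, δ < x i) (hsum : ∑ i, (x i)⁻¹ ≤ δ⁻¹) :
    (∑ i, (x i + -δ)⁻¹) ^ 2 - ∑ i, (x i + -δ)⁻¹ ^ 2 ≤ δ⁻¹ * ∑ i, (x i + -δ)⁻¹ := by
  have hx0 : ∀ i, 0 < x i := fun i => hδ.trans (hx i)
  have hxd : ∀ i, 0 < x i + -δ := fun i => by linarith [hx i]
  -- These weights make `y i * p i` the increment `(x i - δ)⁻¹ - (x i)⁻¹` of the potential.
  have h := sum_mul_le_of_chebyshev (fun i => (x i + -δ)⁻¹) (fun i => δ * (x i)⁻¹)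
    (by rw [← Finset.mul_sum]
        calc _ ≤ δ * δ⁻¹ := by gcongr
          _ = 1 := mul_inv_cancel₀ hδ.ne')
    (by
      intro i j
      have e : ((x j + -δ)⁻¹ - (x i + -δ)⁻¹) *
          (δ * (x i)⁻¹ * (x j + -δ)⁻¹ - δ * (x j)⁻¹ * (x i + -δ)⁻¹) =
          (x i - x j) ^ 2 * (δ * δ / ((x i + -δ) ^ 2 * (x j + -δ) ^ 2 * x i * x j)) := by
        have := (hxd i).ne'
        have := (hxd j).ne'
        have := (hx0 i).ne'
        have := (hx0 j).ne'
        field_simp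
        ring
      rw [e]
      have := hxd i
      have := hxd j
      have := hx0 i
      have := hx0 j
      positivity)
  have e : ∑ i, (x i + -δ)⁻¹ * (δ * (x i)⁻¹) = ∑ i, (x i + -δ)⁻¹ - ∑ i, (x i)⁻¹ := by
    rw [← Finset.sum_sub_distrib]
    refine Finset.sum_congr rfl fun i _ => ?_
    have := (hxd i).ne'
    have := (hx0 i).ne'
    field_simp
    ring
  simp only [e] at h
  have hS : 0 ≤ ∑ i, (x i + -δ)⁻¹ := Finset.sum_nonneg fun i _ => (inv_pos.mpr (hxd i)).le
  nlinarith [mul_le_mul_of_nonneg_left hsum hS]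

/-- The trace of the inverse of a matrix with one row and the same column deleted. -/
theorem trace_inv_submatrix_succAbove {p : ℕ} {X : Matrix (Fin (p + 1)) (Fin (p + 1)) ℝ}
    (hX : IsUnit X) (i : Fin (p + 1)) (hi : X⁻¹ i i ≠ 0) :
    ((X.submatrix i.succAbove i.succAbove)⁻¹).trace =
      X⁻¹.trace - (X⁻¹ * X⁻¹) i i / X⁻¹ i i := by
  obtain ⟨R, hR⟩ : ∃ R, R = X⁻¹ := ⟨_, rfl⟩
  rw [← hR] at hi ⊢
  have hXR : X * R = 1 := by
    rw [hR]; exact Matrix.mul_nonsing_inv _ ((Matrix.isUnit_iff_isUnit_det _).mp hX)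
  -- The rank-one correction of `X⁻¹` that clears row and column `i`; what remains is the inverse of
  -- the submatrix.
  obtain ⟨K, hK⟩ : ∃ K : Matrix (Fin (p + 1)) (Fin (p + 1)) ℝ,
    ∀ a b, K a b = R a b - R a i * R i b / R i i := ⟨fun a b => _, fun a b => rfl⟩
  have hKi : ∀ b, K i b = 0 := fun b => by rw [hK]; field_simp; ring
  have hXK : ∀ a b, a ≠ i → (X * K) a b = (1 : Matrix _ _ ℝ) a b := by
    intro a b ha
    have h1 : (X * K) a b = (X * R) a b - (X * R) a i * (R i b / R i i) := by
      simp only [Matrix.mul_apply, hK, mul_sub, Finset.sum_sub_distrib, Finset.sum_mul]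
      congr 1
      exact Finset.sum_congr rfl fun j _ => by ring
    rw [h1, hXR, Matrix.one_apply_ne ha]
    ring
  have hinv : (X.submatrix i.succAbove i.succAbove)⁻¹ = K.submatrix i.succAbove i.succAbove := by
    apply Matrix.inv_eq_right_inv
    ext a b
    have h := hXK (i.succAbove a) (i.succAbove b) (Fin.succAbove_ne i a)
    rw [Matrix.mul_apply, Fin.sum_univ_succAbove _ i, hKi, mul_zero, zero_add] at h
    rw [Matrix.mul_apply]
    simp only [Matrix.submatrix_apply]
    rw [h]
    simp [Matrix.one_apply]
  have ht : K.trace = R.trace - (R * R) i i / R i i := by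
    simp only [Matrix.trace, Matrix.diag, hK, Finset.sum_sub_distrib, Matrix.mul_apply,
      Finset.sum_div]
    congr 1
    exact Finset.sum_congr rfl fun j _ => by ring
  rw [hinv, ← ht, Matrix.trace, Matrix.trace, Fin.sum_univ_succAbove _ i]
  simp [hKi]

theorem posSemidef_sub_of_trace_inv_le {p : ℕ} {X : Matrix (Fin p) (Fin p) ℝ}
    (hX : X.PosDef) {δ : ℝ} (hδ : 0 < δ) (ht : X⁻¹.trace ≤ δ⁻¹) :
    (X + (-δ) • (1 : Matrix (Fin p) (Fin p) ℝ)).PosSemidef := by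
  have hpos := hX.eigenvalues_pos
  have h := trace_inv_add_smul_one hX.1 (s := 0) (fun i => by simpa using (hpos i).ne')
  simp only [zero_smul, add_zero] at h
  rw [h] at ht
  refine posSemidef_add_smul_one hX.1 fun i => ?_
  have h1 : (hX.1.eigenvalues i)⁻¹ ≤ δ⁻¹ := (Finset.single_le_sum
    (f := fun i => (hX.1.eigenvalues i)⁻¹)
    (fun j _ => (inv_pos.mpr (hpos j)).le) (Finset.mem_univ i)).trans ht
  have := (inv_le_inv₀ (hpos i) hδ).mp h1
  linarith

/-- One row and column can be deleted while the barrier moves up by `δ` and the potential stays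
bounded by `δ⁻¹`. -/
theorem exists_delete {p : ℕ} {X : Matrix (Fin (p + 2)) (Fin (p + 2)) ℝ}
    (hX : X.PosDef) {δ : ℝ} (hδ : 0 < δ) (ht : X⁻¹.trace ≤ δ⁻¹) :
    ∃ i : Fin (p + 2),
      ((X + (-δ) • (1 : Matrix _ _ ℝ)).submatrix i.succAbove i.succAbove).PosDef ∧
      (((X + (-δ) • (1 : Matrix _ _ ℝ)).submatrix i.succAbove i.succAbove)⁻¹).trace ≤ δ⁻¹ := by
  have hpos := hX.eigenvalues_pos
  have h := trace_inv_add_smul_one hX.1 (s := 0) (fun i => by simpa using (hpos i).ne')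
  simp only [zero_smul, add_zero] at h
  rw [h] at ht
  -- Strict because the size is at least two: another eigenvalue also contributes to the trace.
  have hlt : ∀ i, δ < hX.1.eigenvalues i := by
    intro i
    have h1 : (hX.1.eigenvalues i)⁻¹ < ∑ j, (hX.1.eigenvalues j)⁻¹ := by
      obtain ⟨j, hj⟩ := exists_ne i
      exact Finset.single_lt_sum (f := fun i => (hX.1.eigenvalues i)⁻¹) hj (Finset.mem_univ i)
        (Finset.mem_univ j) (inv_pos.mpr (hpos j)) (fun k _ _ => (inv_pos.mpr (hpos k)).le)
    exact (inv_lt_inv₀ (hpos i) hδ).mp (h1.trans_le ht)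
  have hlt' : ∀ i, 0 < hX.1.eigenvalues i + -δ := fun i => by linarith [hlt i]
  have key := sq_sum_inv_sub_le hδ hlt ht
  rw [← trace_inv_add_smul_one hX.1 (fun i => (hlt' i).ne'),
    ← trace_inv_mul_inv_add_smul_one hX.1 (fun i => (hlt' i).ne')] at key
  have hZ := posDef_add_smul_one hX.1 hlt'
  obtain ⟨Z, hZdef⟩ : ∃ Z, Z = X + (-δ) • (1 : Matrix (Fin (p + 2)) (Fin (p + 2)) ℝ) := ⟨_, rfl⟩
  rw [← hZdef] at key hZ ⊢
  have hR : ∀ i, 0 < Z⁻¹ i i := fun i => hZ.inv.diag_pos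
  -- Averaging: summed over `i`, this inequality is `key`. Divided by `Z⁻¹ i i > 0`, it bounds the
  -- potential after deleting `i`.
  obtain ⟨i, -, hi⟩ : ∃ i ∈ Finset.univ,
      Z⁻¹.trace * Z⁻¹ i i - (Z⁻¹ * Z⁻¹) i i ≤ δ⁻¹ * Z⁻¹ i i := by
    apply Finset.exists_le_of_sum_le Finset.univ_nonempty
    rw [Finset.sum_sub_distrib, ← Finset.mul_sum, ← Finset.mul_sum]
    simpa [sq, Matrix.trace] using key
  refine ⟨i, hZ.submatrix Fin.succAbove_right_injective, ?_⟩
  rw [trace_inv_submatrix_succAbove hZ.isUnit i (hR i).ne']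
  rw [sub_le_iff_le_add, ← sub_le_iff_le_add', le_div_iff₀ (hR i)]
  linarith

/-- Each of the `k` deletions gains `δ`. The extra `δ` comes from the end, where a potential at most
`δ⁻¹` already forces every eigenvalue to be at least `δ`. -/
theorem exists_embedding_posSemidef (k p : ℕ) {N : ℕ} (hN : N = k + p + 1)
    {X : Matrix (Fin N) (Fin N) ℝ} (hX : X.PosDef) {δ : ℝ} (hδ : 0 < δ)
    (ht : X⁻¹.trace ≤ δ⁻¹) :
    ∃ f : Fin (p + 1) → Fin N, Function.Injective f ∧
      (X.submatrix f f + (-((k + 1) * δ)) • (1 : Matrix _ _ ℝ)).PosSemidef := by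
  induction k generalizing N with
  | zero =>
    obtain rfl : N = p + 1 := by omega
    refine ⟨id, Function.injective_id, ?_⟩
    simpa using posSemidef_sub_of_trace_inv_le hX hδ ht
  | succ k ih =>
    obtain rfl : N = k + p + 2 := by omega
    obtain ⟨i, hi, hit⟩ := exists_delete hX hδ ht
    obtain ⟨f, hf, hpos⟩ := ih rfl hi hit
    refine ⟨i.succAbove ∘ f, Fin.succAbove_right_injective.comp hf, ?_⟩
    convert hpos using 1
    ext a b
    have : (1 : Matrix (Fin (k + p + 2)) (Fin (k + p + 2)) ℝ) (i.succAbove (f a))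
        (i.succAbove (f b)) = (1 : Matrix (Fin (p + 1)) (Fin (p + 1)) ℝ) a b := by
      simp [Matrix.one_apply, hf.eq_iff]
    simp only [Matrix.add_apply, Matrix.smul_apply, Matrix.submatrix_apply, Function.comp_apply,
      this, smul_eq_mul]
    push_cast
    ring

end Delete

/-! ### Estimates for the potential and the optimal barrier -/

section Real

/-- Splits off the pole at `t = 0`. With `0⁻¹ = 0`, the second term is regular there and vanishes
for `c = 0`. -/
theorem inv_add_eq_ite_add {c t : ℝ} (hc : 0 ≤ c) (ht : 0 < t) :
    (c + t)⁻¹ = (if c = 0 then 1 else 0) / t + c⁻¹ / (1 + t * c⁻¹) := by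
  split_ifs with h
  · simp [h]
  · have : 0 < c := lt_of_le_of_ne hc (Ne.symm h)
    field_simp
    simp

theorem sum_inv_add {ι : Type*} [Fintype ι] {c : ι → ℝ} (hc : ∀ i, 0 ≤ c i) {t : ℝ} (ht : 0 < t) :
    ∑ i, (c i + t)⁻¹ = ((Finset.univ.filter fun i => c i = 0).card : ℝ) / t
      + ∑ i, (c i)⁻¹ / (1 + t * (c i)⁻¹) := by
  simp only [fun i => inv_add_eq_ite_add (hc i) ht, Finset.sum_add_distrib]
  rw [← Finset.sum_div, Finset.sum_boole]

theorem tendsto_sum_inv_div {ι : Type*} [Fintype ι] (c : ι → ℝ) :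
    Tendsto (fun t : ℝ => ∑ i, (c i)⁻¹ / (1 + t * (c i)⁻¹)) (𝓝[>] 0) (𝓝 (∑ i, (c i)⁻¹)) := by
  have : ContinuousAt (fun t : ℝ => ∑ i, (c i)⁻¹ / (1 + t * (c i)⁻¹)) 0 := by
    refine tendsto_finsetSum _ fun i _ => ?_
    refine ContinuousAt.div (by fun_prop) (by fun_prop) (by simp)
  have h := this.tendsto
  simp only [zero_mul, add_zero, div_one] at h
  exact h.mono_left nhdsWithin_le_nhds

/-- Comparing principal parts and constant terms at `t = 0`. -/
theorem card_and_sum_inv_of_sum_inv_add_eq {ι κ : Type*} [Fintype ι] [Fintype κ] {c : ι → ℝ}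
    {e : κ → ℝ} (hc : ∀ i, 0 ≤ c i) (he : ∀ i, 0 ≤ e i) {α β : ℝ}
    (h : ∀ t : ℝ, 0 < t → ∑ i, (c i + t)⁻¹ = α / (1 + t) + β / t + ∑ i, (e i + t)⁻¹) :
    ((Finset.univ.filter fun i => c i = 0).card : ℝ) =
        β + (Finset.univ.filter fun i => e i = 0).card ∧
      ∑ i, (c i)⁻¹ = α + ∑ i, (e i)⁻¹ := by
  obtain ⟨z, hz⟩ : ∃ z : ℝ, z = (Finset.univ.filter fun i => c i = 0).card := ⟨_, rfl⟩
  obtain ⟨w, hw⟩ : ∃ w : ℝ, w = (Finset.univ.filter fun i => e i = 0).card := ⟨_, rfl⟩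
  have h' : ∀ t : ℝ, 0 < t → (z - β - w) / t = α / (1 + t) +
      ∑ i, (e i)⁻¹ / (1 + t * (e i)⁻¹) - ∑ i, (c i)⁻¹ / (1 + t * (c i)⁻¹) := by
    intro t ht
    have := h t ht
    rw [sum_inv_add hc ht, sum_inv_add he ht, ← hz, ← hw] at this
    rw [sub_div, sub_div]
    linarith
  have hα : Tendsto (fun t : ℝ => α / (1 + t)) (𝓝[>] 0) (𝓝 α) := by
    have : ContinuousAt (fun t : ℝ => α / (1 + t)) 0 :=
      ContinuousAt.div (by fun_prop) (by fun_prop) (by simp)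
    have h := this.tendsto
    simp only [add_zero, div_one] at h
    exact h.mono_left nhdsWithin_le_nhds
  have hlim := (hα.add (tendsto_sum_inv_div e)).sub (tendsto_sum_inv_div c)
  have hlim' := hlim.congr' (eventually_nhdsWithin_of_forall
    (fun t (ht : t ∈ Set.Ioi 0) => (h' t ht).symm))
  have hid : Tendsto (fun t : ℝ => t) (𝓝[>] 0) (𝓝 0) := tendsto_id.mono_left nhdsWithin_le_nhds
  have h0 : Tendsto (fun _ : ℝ => z - β - w) (𝓝[>] (0 : ℝ)) (𝓝 0) := by
    have := hlim'.mul hid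
    rw [mul_zero] at this
    refine this.congr' (eventually_nhdsWithin_of_forall fun t (ht : 0 < t) => ?_)
    field_simp
  have hzw : z - β - w = 0 := tendsto_nhds_unique tendsto_const_nhds h0
  have hconst : Tendsto (fun _ : ℝ => (0 : ℝ)) (𝓝[>] (0 : ℝ)) (𝓝 (α + ∑ i, (e i)⁻¹ -
      ∑ i, (c i)⁻¹)) := hlim'.congr fun t => by rw [hzw, zero_div]
  have := tendsto_nhds_unique tendsto_const_nhds hconst
  rw [← hz, ← hw]
  exact ⟨by linarith, by linarith⟩

/-- Concavity of `w ↦ w / (1 + t w)`, with the nonzero `c i` replaced by their harmonic mean. -/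
theorem sum_inv_add_le {ι : Type*} [Fintype ι] {c : ι → ℝ} (hc : ∀ i, 0 ≤ c i) {a d h t : ℝ}
    (ht : 0 < t) (hh : 0 < h) (ha : ((Finset.univ.filter fun i => c i = 0).card : ℝ) = a)
    (hd : (Fintype.card ι : ℝ) = a + d) (hH : ∑ i, (c i)⁻¹ = d / h) :
    ∑ i, (c i + t)⁻¹ ≤ a / t + d / (h + t) := by
  rw [sum_inv_add hc ht, ha]
  have hcard : ((Finset.univ.filter fun i => c i ≠ 0).card : ℝ) = d := by
    have := Finset.card_filter_add_card_filter_not (s := Finset.univ) (fun i => c i = 0)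
    rw [Finset.card_univ] at this
    have : ((Finset.univ.filter fun i => c i = 0).card : ℝ)
      + (Finset.univ.filter fun i => c i ≠ 0).card = Fintype.card ι := by exact_mod_cast this
    linarith
  -- The tangent at `w = h⁻¹`, the mean of the nonzero `(c i)⁻¹`.
  have tangent : ∀ i, (c i)⁻¹ / (1 + t * (c i)⁻¹) ≤ (if c i ≠ 0 then 1 else 0) *
      ((h + t)⁻¹ - h / (h + t) ^ 2) + (c i)⁻¹ * (h ^ 2 / (h + t) ^ 2) := by
    intro i
    by_cases h0 : c i = 0
    · simp [h0]
    · have hci : 0 < c i := lt_of_le_of_ne (hc i) (Ne.symm h0)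
      rw [if_pos h0, ← sub_nonneg]
      have e : 1 * ((h + t)⁻¹ - h / (h + t) ^ 2) + (c i)⁻¹ * (h ^ 2 / (h + t) ^ 2) -
          (c i)⁻¹ / (1 + t * (c i)⁻¹) = t * (h - c i) ^ 2 / (c i * (h + t) ^ 2 * (c i + t)) := by
        field_simp
        ring
      rw [e]
      positivity
  have hsum := Finset.sum_le_sum fun i (_ : i ∈ Finset.univ) => tangent i
  rw [Finset.sum_add_distrib, ← Finset.sum_mul, ← Finset.sum_mul, Finset.sum_boole, hcard, hH]
    at hsum
  have e : d * ((h + t)⁻¹ - h / (h + t) ^ 2) + d / h * (h ^ 2 / (h + t) ^ 2) = d / (h + t) := by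
    field_simp
    ring
  linarith

/-- The left side is the supremum over `t` of the bounds in `hL`. It is approached as `t → 0` if `a
= 0`, as `t → ∞` if `a > 0` and `B = 0`, and is attained otherwise. -/
theorem optimize_barrier {a d B h K L : ℝ} (ha : 0 ≤ a) (hd : 0 < d) (hB : 0 ≤ B) (hh : 0 < h)
    (haK : a < K) (hm : a + d = K + B)
    (hL : ∀ t : ℝ, 0 < t → -t + K * (a / t + d / (h + t))⁻¹ ≤ L) :
    (√(K * d) - √(a * B)) ^ 2 / (a + d) ^ 2 * h ≤ L := by
  have hK : 0 < K := by linarith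
  rcases ha.eq_or_lt with rfl | ha
  · have h1 : (√(K * d) - √(0 * B)) ^ 2 / (0 + d) ^ 2 * h = K * h / d := by
      simp only [zero_mul, Real.sqrt_zero, sub_zero, zero_add]
      rw [Real.sq_sqrt (by positivity)]
      field_simp
    rw [h1]
    have hlim : Tendsto (fun t : ℝ => -t + K * (h + t) / d) (𝓝[>] 0) (𝓝 (K * h / d)) := by
      have : ContinuousAt (fun t : ℝ => -t + K * (h + t) / d) 0 := by fun_prop
      have h := this.tendsto
      simp only [neg_zero, add_zero, zero_add] at h
      exact h.mono_left nhdsWithin_le_nhds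
    refine le_of_tendsto hlim (eventually_nhdsWithin_of_forall fun t (ht : 0 < t) => ?_)
    have := hL t ht
    rwa [zero_div, zero_add, inv_div, ← mul_div_assoc] at this
  rcases hB.eq_or_lt with rfl | hB
  · have hKm : K = a + d := by linarith
    have h1 : (√(K * d) - √(a * 0)) ^ 2 / (a + d) ^ 2 * h = d * h / (0 * a * h + (a + d)) := by
      rw [mul_zero, Real.sqrt_zero, sub_zero, Real.sq_sqrt (by positivity), hKm]
      field_simp
      simp
    rw [h1]
    have hlim : Tendsto (fun s : ℝ => d * h / (s * a * h + (a + d))) (𝓝[>] 0)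
        (𝓝 (d * h / (0 * a * h + (a + d)))) := by
      have : ContinuousAt (fun s : ℝ => d * h / (s * a * h + (a + d))) 0 :=
        ContinuousAt.div (by fun_prop) (by fun_prop) (by simp; positivity)
      exact this.tendsto.mono_left nhdsWithin_le_nhds
    refine le_of_tendsto hlim (eventually_nhdsWithin_of_forall fun s (hs : 0 < s) => ?_)
    have h2 := hL s⁻¹ (inv_pos.mpr hs)
    refine le_trans (le_of_eq ?_) h2
    rw [hKm]
    have : 0 < h + s⁻¹ := by positivity
    have : 0 < h * s + 1 := by positivity
    have : 0 < a * s * (h + s⁻¹) + d := by positivity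
    field_simp
    ring
  · obtain ⟨P, hP⟩ : ∃ P, P = √(K * d) := ⟨_, rfl⟩
    obtain ⟨Q, hQ⟩ : ∃ Q, Q = √(a * B) := ⟨_, rfl⟩
    have hP0 : 0 < P := by rw [hP]; positivity
    have hQ0 : 0 < Q := by rw [hQ]; positivity
    have hP2 : P ^ 2 = K * d := by rw [hP]; exact Real.sq_sqrt (by positivity)
    have hQ2 : Q ^ 2 = a * B := by rw [hQ]; exact Real.sq_sqrt (by positivity)
    have hQP : Q < P := by
      refine lt_of_pow_lt_pow_left₀ 2 hP0.le ?_
      rw [hP2, hQ2]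
      nlinarith
    rw [← hP, ← hQ]
    -- The critical point: stationarity reads `a * h + (a + d) * t = a * h * P / Q`.
    have h2 := hL (h * (a * (P - Q) / (Q * (a + d)))) (by
      have : 0 < P - Q := by linarith
      positivity)
    refine le_trans (le_of_eq ?_) h2
    have hPQ : 0 < P - Q := by linarith
    have hpot : a / (h * (a * (P - Q) / (Q * (a + d)))) +
        d / (h + h * (a * (P - Q) / (Q * (a + d)))) =
        Q * (a + d) ^ 2 * P / (h * (P - Q) * (Q * d + a * P)) := by
      have e : h + h * (a * (P - Q) / (Q * (a + d))) = h * (Q * d + a * P) / (Q * (a + d)) := by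
        field_simp
        ring
      rw [e]
      field_simp
      ring
    have hKe : K = P ^ 2 / d := by field_simp; linarith
    have hrel : a * P ^ 2 + d * Q ^ 2 = a * d * (a + d) := by
      rw [hP2, hQ2, hm]
      ring
    rw [hpot, inv_div, hKe]
    field_simp
    linear_combination (-1) * hrel

end Real

/-! ### Lower bounds for singular values -/

section SingularValues

/-- For `c > 0` the adjoint is injective, so `T` has full rank and the singular value is positive.
Its right singular vector `v` then has `T v ≠ 0`, and `hT` is tested on `T v`. -/
theorem le_sq_singularValues {E F : Type*} [NormedAddCommGroup E] [InnerProductSpace ℝ E]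
    [FiniteDimensional ℝ E] [NormedAddCommGroup F] [InnerProductSpace ℝ F] [FiniteDimensional ℝ F]
    (T : E →ₗ[ℝ] F) {c : ℝ} (hT : ∀ x, c * ‖x‖ ^ 2 ≤ ‖T.adjoint x‖ ^ 2) {i : ℕ}
    (hi : i < Module.finrank ℝ F) : c ≤ T.singularValues i ^ 2 := by
  rcases le_or_gt c 0 with hc | hc
  · exact hc.trans (sq_nonneg _)
  have hinj : Function.Injective T.adjoint := by
    rw [injective_iff_map_eq_zero]
    intro x hx
    have := hT x
    rw [hx, norm_zero] at this
    have h0 : ‖x‖ ^ 2 ≤ 0 := by nlinarith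
    simpa using h0
  have hrank : Module.finrank ℝ T.range = Module.finrank ℝ F := by
    rw [← LinearMap.finrank_range_adjoint]
    exact LinearMap.finrank_range_of_inj hinj
  have hpos : 0 < T.singularValues i := by
    rw [LinearMap.singularValues_pos_iff_lt_finrank_range, hrank]
    exact hi
  have hiE : i < Module.finrank ℝ E := by
    by_contra h
    rw [T.singularValues_of_finrank_le (not_lt.mp h)] at hpos
    exact lt_irrefl _ hpos
  obtain ⟨v, hv⟩ := (T.hasEigenvalue_adjoint_comp_self_sq_singularValues hiE).exists_hasEigenvector
  have hv1 : T.adjoint (T v) = T.singularValues i ^ 2 • v := hv.apply_eq_smul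
  have hTv : T v ≠ 0 := by
    intro h
    rw [h, map_zero] at hv1
    exact (smul_ne_zero (pow_pos hpos 2).ne' hv.2) hv1.symm
  have h1 : ‖T.adjoint (T v)‖ ^ 2 = T.singularValues i ^ 2 * ‖T v‖ ^ 2 := by
    rw [← real_inner_self_eq_norm_sq, LinearMap.adjoint_inner_left, hv1, map_smul,
      real_inner_smul_right, real_inner_self_eq_norm_sq]
  have h2 := hT (T v)
  rw [h1] at h2
  exact le_of_mul_le_mul_right h2 (by positivity)

variable {p q : Type*} [Fintype p] [Fintype q]

theorem le_sq_sigmaMin [DecidableEq q] [Nonempty p] (A : Matrix p q ℝ)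
    (hcard : Fintype.card p ≤ Fintype.card q) {c : ℝ}
    (hc : ∀ x : p → ℝ, c * (x ⬝ᵥ x) ≤ (Aᵀ *ᵥ x) ⬝ᵥ (Aᵀ *ᵥ x)) : c ≤ sigmaMin A ^ 2 := by
  classical
  refine le_sq_singularValues _ (fun x => ?_) ?_
  · rw [← Matrix.toEuclideanLin_conjTranspose_eq_adjoint, EuclideanSpace.real_norm_sq_eq,
      EuclideanSpace.real_norm_sq_eq]
    simpa [dotProduct, sq] using hc x
  · rw [min_eq_left hcard, finrank_euclideanSpace]
    exact Nat.sub_lt Fintype.card_pos one_pos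

/-- A bound for `N` in operator norm is a bound for its transpose. -/
theorem transpose_mulVec_dotProduct_le (N : Matrix p q ℝ) {κ : ℝ} (hκ : 0 ≤ κ)
    (h : ∀ y, (N *ᵥ y) ⬝ᵥ (N *ᵥ y) ≤ κ * (y ⬝ᵥ y)) (x : p → ℝ) :
    (Nᵀ *ᵥ x) ⬝ᵥ (Nᵀ *ᵥ x) ≤ κ * (x ⬝ᵥ x) := by
  obtain ⟨y, hy⟩ : ∃ y, y = Nᵀ *ᵥ x := ⟨_, rfl⟩
  rw [← hy]
  have hx : 0 ≤ x ⬝ᵥ x := Finset.sum_nonneg fun i _ => mul_self_nonneg _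
  have hyy : 0 ≤ y ⬝ᵥ y := Finset.sum_nonneg fun i _ => mul_self_nonneg _
  have h1 : y ⬝ᵥ y = x ⬝ᵥ (N *ᵥ y) := by
    rw [Matrix.dotProduct_mulVec, ← Matrix.mulVec_transpose, ← hy]
  -- Cauchy–Schwarz; one factor `y ⬝ᵥ y` is cancelled at the end.
  have h2 : (x ⬝ᵥ (N *ᵥ y)) ^ 2 ≤ (x ⬝ᵥ x) * ((N *ᵥ y) ⬝ᵥ (N *ᵥ y)) := by
    have := Finset.sum_mul_sq_le_sq_mul_sq Finset.univ x (N *ᵥ y)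
    simpa only [dotProduct, sq] using this
  rw [← h1] at h2
  rcases hyy.eq_or_lt with h0 | h0
  · rw [← h0]; positivity
  · have h3 := h2.trans (mul_le_mul_of_nonneg_left (h y) hx)
    have : (y ⬝ᵥ y) * (y ⬝ᵥ y) ≤ (κ * (x ⬝ᵥ x)) * (y ⬝ᵥ y) := by nlinarith
    exact le_of_mul_le_mul_right this h0

end SingularValues

/-! ### Frobenius norm of the pseudoinverse -/

section Pseudoinverse

variable {p q : Type*} [Fintype p] [Fintype q]

theorem frobenius_norm_sq_eq_trace (A : Matrix p q ℝ) : ‖A‖ ^ 2 = (A * Aᵀ).trace := by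
  rw [Matrix.frobenius_norm_def, ← Real.sqrt_eq_rpow, Real.sq_sqrt (by positivity)]
  simp [Matrix.trace, Matrix.mul_apply, sq]

/-- `A† * A†ᵀ` is the pseudoinverse of `Aᵀ * A`; zero eigenvalues contribute `0⁻¹ = 0`. -/
theorem norm_pinv_sq [DecidableEq q] (A : Matrix p q ℝ) :
    ‖pinv A‖ ^ 2 = ∑ i, ((Matrix.isHermitian_conjTranspose_mul_self A).eigenvalues i)⁻¹ := by
  have hA : (Aᴴ * A).IsHermitian := Matrix.isHermitian_conjTranspose_mul_self A
  obtain ⟨U, hU⟩ : ∃ U : Matrix q q ℝ, U = (hA.eigenvectorUnitary : Matrix q q ℝ) := ⟨_, rfl⟩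
  obtain ⟨d, hd⟩ : ∃ d : q → ℝ, d = hA.eigenvalues := ⟨_, rfl⟩
  have hX : pinv A = U * Matrix.diagonal (fun i => (d i)⁻¹) * Uᵀ * Aᵀ := by
    rw [hU, hd]
    rfl
  have hUU : Uᵀ * U = 1 := by
    have h := Matrix.UnitaryGroup.star_mul_self hA.eigenvectorUnitary
    rwa [← hU, Matrix.star_eq_conjTranspose, Matrix.conjTranspose_eq_transpose_of_trivial] at h
  have hH : Aᵀ * A = U * Matrix.diagonal d * Uᵀ := by
    have h := hA.spectral_theorem
    rw [Unitary.conjStarAlgAut_apply, ← hU, Matrix.star_eq_conjTranspose,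
      Matrix.conjTranspose_eq_transpose_of_trivial U] at h
    rw [← Matrix.conjTranspose_eq_transpose_of_trivial A, h, hd]
    rfl
  have hXt : (pinv A)ᵀ = A * (U * Matrix.diagonal (fun i => (d i)⁻¹) * Uᵀ) := by
    simp [hX, Matrix.transpose_mul, Matrix.mul_assoc]
  have hXX : pinv A * (pinv A)ᵀ = U * Matrix.diagonal (fun i => (d i)⁻¹) * Uᵀ := by
    rw [hXt, hX, Matrix.mul_assoc _ Aᵀ, ← Matrix.mul_assoc Aᵀ, hH, conj_diagonal_mul hUU,
      conj_diagonal_mul hUU]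
    congr 3
    funext i
    by_cases h : d i = 0 <;> simp [h]
  rw [frobenius_norm_sq_eq_trace, hXX, trace_conj_diagonal hUU, hd]

end Pseudoinverse

/-! ### Spectrum of the complementary Gram matrix -/

section Complement

variable {p q κ : Type*} [Fintype p] [Fintype q] [Fintype κ] [DecidableEq p]
  [DecidableEq κ] {M : Matrix p q ℝ} {N : Matrix p κ ℝ}

theorem posSemidef_one_sub_transpose_mul_self (hMN : M * Mᵀ + N * Nᵀ = 1) :
    (1 - Nᵀ * N).PosSemidef := by
  refine Matrix.PosSemidef.of_dotProduct_mulVec_nonneg ?_ fun x => ?_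
  · simp [Matrix.IsHermitian, Matrix.conjTranspose_eq_transpose_of_trivial]
  · have h := transpose_mulVec_dotProduct_le Nᵀ zero_le_one (fun y => by
      have h1 : (Nᵀ *ᵥ y) ⬝ᵥ (Nᵀ *ᵥ y) = y ⬝ᵥ ((N * Nᵀ) *ᵥ y) := by
        rw [← Matrix.mulVec_mulVec, Matrix.dotProduct_mulVec y, ← Matrix.mulVec_transpose]
      have h2 : (Mᵀ *ᵥ y) ⬝ᵥ (Mᵀ *ᵥ y) = y ⬝ᵥ ((M * Mᵀ) *ᵥ y) := by
        rw [← Matrix.mulVec_mulVec, Matrix.dotProduct_mulVec y, ← Matrix.mulVec_transpose]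
      have h3 : y ⬝ᵥ ((M * Mᵀ) *ᵥ y) + y ⬝ᵥ ((N * Nᵀ) *ᵥ y) = y ⬝ᵥ y := by
        rw [← dotProduct_add, ← Matrix.add_mulVec, hMN, Matrix.one_mulVec]
      have h4 : 0 ≤ (Mᵀ *ᵥ y) ⬝ᵥ (Mᵀ *ᵥ y) := Finset.sum_nonneg fun i _ => mul_self_nonneg _
      linarith) x
    rw [Matrix.transpose_transpose, one_mul] at h
    have h1 : (N *ᵥ x) ⬝ᵥ (N *ᵥ x) = x ⬝ᵥ ((Nᵀ * N) *ᵥ x) := by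
      rw [← Matrix.mulVec_mulVec, Matrix.dotProduct_mulVec x, ← Matrix.mulVec_transpose,
        Matrix.transpose_transpose]
    rw [star_trivial, Matrix.sub_mulVec, dotProduct_sub, Matrix.one_mulVec]
    linarith

theorem posDef_add_smul_one_of_posSemidef {X : Matrix κ κ ℝ} (hX : X.PosSemidef) {t : ℝ}
    (ht : 0 < t) : (X + t • (1 : Matrix κ κ ℝ)).PosDef :=
  posDef_add_smul_one hX.1 fun i => by linarith [hX.eigenvalues_nonneg i]

/-- The spectrum of `1 - Nᵀ N`, in terms of `M`. -/
theorem card_and_sum_inv_eigenvalues [DecidableEq q] (hMN : M * Mᵀ + N * Nᵀ = 1) :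
    ((Finset.univ.filter fun i =>
        (posSemidef_one_sub_transpose_mul_self hMN).1.eigenvalues i = 0).card : ℝ) =
        Fintype.card p - M.rank ∧
      ∑ i, ((posSemidef_one_sub_transpose_mul_self hMN).1.eigenvalues i)⁻¹ =
        Fintype.card κ - Fintype.card p + ‖pinv M‖ ^ 2 := by
  have hC := posSemidef_one_sub_transpose_mul_self hMN
  have hS := Matrix.posSemidef_conjTranspose_mul_self M
  have hT : (M * Mᵀ).PosSemidef := by
    simpa [Matrix.conjTranspose_eq_transpose_of_trivial] using
      Matrix.posSemidef_self_mul_conjTranspose M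
  have key := card_and_sum_inv_of_sum_inv_add_eq (c := hC.1.eigenvalues) (e := hS.1.eigenvalues)
    (α := (Fintype.card κ : ℝ) - Fintype.card p) (β := (Fintype.card p : ℝ) - Fintype.card q)
    hC.eigenvalues_nonneg hS.eigenvalues_nonneg (by
      intro t ht
      have hCt := posDef_add_smul_one_of_posSemidef hC ht
      have hSt := posDef_add_smul_one_of_posSemidef hS ht
      have hTt := posDef_add_smul_one_of_posSemidef hT ht
      -- Two commutations link `1 - Nᵀ * N` to `1 - N * Nᵀ = M * Mᵀ`, and that to `Mᵀ * M`. The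
      -- first has parameter `1 + t`, hence adds no pole at `t = 0`.
      have e1 : (-Nᵀ) * N + (1 + t) • (1 : Matrix κ κ ℝ) = 1 - Nᵀ * N + t • 1 := by
        rw [add_smul, one_smul, Matrix.neg_mul]
        abel
      have e2 : N * (-Nᵀ) + (1 + t) • (1 : Matrix p p ℝ) = M * Mᵀ + t • 1 := by
        rw [add_smul, one_smul, Matrix.mul_neg, ← add_assoc]
        nth_rewrite 1 [← hMN]
        abel
      have h1 := trace_inv_mul_comm (-Nᵀ) N (s := 1 + t) (by positivity)
        (by rw [e1]; exact hCt.isUnit) (by rw [e2]; exact hTt.isUnit)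
      have h2 := trace_inv_mul_comm M Mᵀ (s := t) ht.ne' hTt.isUnit hSt.isUnit
      rw [e1, e2, trace_inv_add_smul_one hC.1
        (fun i => by linarith [hC.eigenvalues_nonneg i])] at h1
      have h3 := trace_inv_add_smul_one hS.1 (s := t)
        (fun i => by linarith [hS.eigenvalues_nonneg i])
      rw [← h3, h1, h2, ← add_assoc]
      rfl)
  refine ⟨?_, ?_⟩
  · rw [key.1]
    have hr : M.rank = (Finset.univ.filter fun i => hS.1.eigenvalues i ≠ 0).card := by
      rw [← Matrix.rank_conjTranspose_mul_self, hS.1.rank_eq_card_non_zero_eigs,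
        Fintype.card_subtype]
    have := Finset.card_filter_add_card_filter_not (s := Finset.univ)
      (fun i => hS.1.eigenvalues i = 0)
    rw [Finset.card_univ] at this
    rw [hr, ← this]
    push_cast
    ring
  · rw [key.2, norm_pinv_sq]

end Complement

/-! ### From principal submatrices to column selections -/

section Selection

theorem cols_mul_transpose_add {n N m : ℕ} (Y : Matrix (Fin n) (Fin N) ℝ) (S : Finset (Fin N))
    {g : Fin m → Fin N} (hg : Function.Injective g) (hS : Finset.univ.image g = Sᶜ) :
    cols Y S * (cols Y S)ᵀ + Y.submatrix id g * (Y.submatrix id g)ᵀ = Y * Yᵀ := by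
  ext i j
  simp only [Matrix.add_apply, Matrix.mul_apply, Matrix.transpose_apply, cols,
    Matrix.submatrix_apply, id]
  rw [Finset.sum_coe_sort S fun a => Y i a * Y j a,
    ← Finset.sum_image (s := Finset.univ) (g := g) (f := fun a => Y i a * Y j a) hg.injOn, hS,
    Finset.sum_add_sum_compl]

theorem fromCols_transpose_mulVec_dotProduct {n N : ℕ} (Y : Matrix (Fin n) (Fin N) ℝ)
    (S T : Finset (Fin N)) (x : Fin n → ℝ) :
    ((Matrix.fromCols (cols Y S) (cols Y T))ᵀ *ᵥ x) ⬝ᵥ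
        ((Matrix.fromCols (cols Y S) (cols Y T))ᵀ *ᵥ x) =
      ∑ j ∈ S, (Yᵀ *ᵥ x) j ^ 2 + ∑ j ∈ T, (Yᵀ *ᵥ x) j ^ 2 := by
  rw [dotProduct, Fintype.sum_sum_type, ← Finset.sum_coe_sort S, ← Finset.sum_coe_sort T]
  simp [Matrix.mulVec, dotProduct, cols, sq]

theorem mulVec_dotProduct_le_of_posSemidef {n p : ℕ} {N : Matrix (Fin n) (Fin (p + 1)) ℝ} {c : ℝ}
    (h : (1 - Nᵀ * N + (-c) • (1 : Matrix (Fin (p + 1)) (Fin (p + 1)) ℝ)).PosSemidef)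
    (x : Fin n → ℝ) : (Nᵀ *ᵥ x) ⬝ᵥ (Nᵀ *ᵥ x) ≤ (1 - c) * (x ⬝ᵥ x) := by
  have hN : ∀ y, (N *ᵥ y) ⬝ᵥ (N *ᵥ y) ≤ (1 - c) * (y ⬝ᵥ y) := by
    intro y
    have h1 := h.dotProduct_mulVec_nonneg y
    have h2 : (N *ᵥ y) ⬝ᵥ (N *ᵥ y) = y ⬝ᵥ ((Nᵀ * N) *ᵥ y) := by
      rw [← Matrix.mulVec_mulVec, Matrix.dotProduct_mulVec y, ← Matrix.mulVec_transpose,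
        Matrix.transpose_transpose]
    rw [star_trivial, Matrix.add_mulVec, Matrix.sub_mulVec, dotProduct_add, dotProduct_sub,
      Matrix.smul_mulVec, dotProduct_smul, Matrix.one_mulVec, smul_eq_mul] at h1
    linarith
  refine transpose_mulVec_dotProduct_le N ?_ hN x
  -- Testing on a coordinate vector shows `0 ≤ 1 - c`, as needed for transposition.
  have h1 := hN (Pi.single 0 1)
  have h2 : (0 : ℝ) ≤ (N *ᵥ Pi.single 0 1) ⬝ᵥ (N *ᵥ Pi.single 0 1) :=
    Finset.sum_nonneg fun i _ => mul_self_nonneg _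
  simp only [single_one_dotProduct, Pi.single_eq_same, mul_one] at h1
  linarith

/-- Each barrier `t > 0` yields a selection of `k` columns. -/
theorem exists_columns_le_sq_sigmaMin {n m l k : ℕ} (hn : 1 ≤ n)
    (Y : Matrix (Fin n) (Fin (m + l)) ℝ) (hY : Y * Yᵀ = 1) (S : Finset (Fin (m + l)))
    (hS : S.card = l) (hk : n ≤ k + (cols Y S).rank) (hkm : k + 1 ≤ m) {t : ℝ} (ht : 0 < t) :
    0 < (m : ℝ) - n + ‖pinv (cols Y S)‖ ^ 2 ∧
    ∃ T : Finset (Fin (m + l)), (Disjoint T S ∧ T.card = k) ∧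
      -t + ((k : ℝ) + 1) * (((n : ℝ) - (cols Y S).rank) / t + ((m : ℝ) - n + (cols Y S).rank) /
        (((m : ℝ) - n + (cols Y S).rank) / ((m : ℝ) - n + ‖pinv (cols Y S)‖ ^ 2) + t))⁻¹ ≤
      sigmaMin (Matrix.fromCols (cols Y S) (cols Y T)) ^ 2 := by
  obtain ⟨p, rfl⟩ : ∃ p, m = k + p + 1 := ⟨m - k - 1, by omega⟩
  have hcard : Sᶜ.card = k + p + 1 := by
    rw [Finset.card_compl, Fintype.card_fin, hS]
    omega
  obtain ⟨g, hg, hgS⟩ : ∃ g : Fin (k + p + 1) → Fin (k + p + 1 + l), Function.Injective g ∧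
      Finset.univ.image g = Sᶜ :=
    ⟨_, (Sᶜ.orderEmbOfFin hcard).injective, Finset.image_orderEmbOfFin_univ _ _⟩
  obtain ⟨N, hN⟩ : ∃ N, N = Y.submatrix id g := ⟨_, rfl⟩
  have hMN : cols Y S * (cols Y S)ᵀ + N * Nᵀ = 1 := by
    rw [hN, cols_mul_transpose_add Y S hg hgS, hY]
  have hC := posSemidef_one_sub_transpose_mul_self hMN
  have hrn : (cols Y S).rank ≤ n := by simpa using Matrix.rank_le_card_height (cols Y S)
  have hrl : (cols Y S).rank ≤ l := by
    simpa [hS] using Matrix.rank_le_card_width (cols Y S)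
  obtain ⟨hzero, hinv⟩ := card_and_sum_inv_eigenvalues hMN
  simp only [Fintype.card_fin] at hzero hinv
  obtain ⟨r, hr⟩ : ∃ r, r = (cols Y S).rank := ⟨_, rfl⟩
  rw [← hr] at hk hrn hrl hzero ⊢
  obtain ⟨H, hH⟩ : ∃ H, H = ((k + p + 1 : ℕ) : ℝ) - n + ‖pinv (cols Y S)‖ ^ 2 := ⟨_, rfl⟩
  rw [← hH] at hinv ⊢
  have hrn' : (r : ℝ) ≤ n := by exact_mod_cast hrn
  have hk' : (n : ℝ) ≤ k + r := by exact_mod_cast hk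
  obtain ⟨a, ha⟩ : ∃ a, a = (n : ℝ) - r := ⟨_, rfl⟩
  obtain ⟨d, hd⟩ : ∃ d, d = ((k + p + 1 : ℕ) : ℝ) - n + r := ⟨_, rfl⟩
  rw [← ha] at hzero
  rw [← ha, ← hd]
  have ha0 : 0 ≤ a := by linarith
  have hd0 : 0 < d := by
    rw [hd]; push_cast
    have : (0 : ℝ) ≤ p := Nat.cast_nonneg p
    linarith
  have hH0 : 0 < H := by
    rw [← hinv]
    refine Finset.sum_pos' (fun i _ => inv_nonneg.mpr (hC.eigenvalues_nonneg i)) ?_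
    -- Otherwise all `m` eigenvalues vanish, whereas only `n - r ≤ k < m` do.
    by_contra hcon
    push Not at hcon
    have hall : (Finset.univ.filter fun i => hC.1.eigenvalues i = 0) = Finset.univ := by
      refine Finset.filter_true_of_mem fun i hi => ?_
      exact inv_eq_zero.mp (le_antisymm (hcon i hi) (inv_nonneg.mpr (hC.eigenvalues_nonneg i)))
    rw [hall, Finset.card_univ, Fintype.card_fin] at hzero
    linarith
  refine ⟨hH0, ?_⟩
  have hpot := sum_inv_add_le hC.eigenvalues_nonneg ht (div_pos hd0 hH0) hzero
    (d := d) (by rw [Fintype.card_fin, ha, hd]; ring) (by rw [hinv]; field_simp)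
  rw [← trace_inv_add_smul_one hC.1 (fun i => by linarith [hC.eigenvalues_nonneg i])] at hpot
  have hφ : 0 < a / t + d / (d / H + t) := by positivity
  obtain ⟨f, hf, hpos⟩ := exists_embedding_posSemidef k p rfl
    (posDef_add_smul_one_of_posSemidef hC ht) (inv_pos.mpr hφ) (by rwa [inv_inv])
  obtain ⟨c, hc⟩ : ∃ c, c = -t + ((k : ℝ) + 1) * (a / t + d / (d / H + t))⁻¹ := ⟨_, rfl⟩
  rw [← hc]
  have hpos' : (1 - (N.submatrix id f)ᵀ * N.submatrix id f +
      (-c) • (1 : Matrix (Fin (p + 1)) (Fin (p + 1)) ℝ)).PosSemidef := by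
    convert hpos using 1
    ext i j
    have h1 : (1 : Matrix (Fin (k + p + 1)) (Fin (k + p + 1)) ℝ) (f i) (f j)
        = (1 : Matrix (Fin (p + 1)) (Fin (p + 1)) ℝ) i j := by
      simp [Matrix.one_apply, hf.eq_iff]
    simp only [Matrix.add_apply, Matrix.sub_apply, Matrix.smul_apply, Matrix.submatrix_apply,
      Matrix.mul_apply, Matrix.transpose_apply, h1, smul_eq_mul, id, hc]
    ring
  have hgf : Function.Injective (g ∘ f) := hg.comp hf
  have hsub : Finset.univ.image (g ∘ f) ⊆ Sᶜ := by
    rw [← hgS, ← Finset.image_image]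
    exact Finset.image_subset_image (Finset.subset_univ _)
  have hTcard : (Sᶜ \ Finset.univ.image (g ∘ f)).card = k := by
    rw [Finset.card_sdiff_of_subset hsub, hcard, Finset.card_image_of_injective _ hgf,
      Finset.card_univ, Fintype.card_fin]
    omega
  -- The indices deleted from `C` are the columns selected; the surviving ones are left out.
  refine ⟨Sᶜ \ Finset.univ.image (g ∘ f), ⟨?_, hTcard⟩, ?_⟩
  · exact disjoint_compl_left.mono_left Finset.sdiff_subset
  have : Nonempty (Fin n) := ⟨⟨0, hn⟩⟩
  refine le_sq_sigmaMin _ ?_ fun x => ?_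
  · simp only [Fintype.card_sum, Fintype.card_coe, Fintype.card_fin, hS, hTcard]
    omega
  · have h1 := mulVec_dotProduct_le_of_posSemidef hpos' x
    have h2 : ((N.submatrix id f)ᵀ *ᵥ x) ⬝ᵥ ((N.submatrix id f)ᵀ *ᵥ x) =
        ∑ j ∈ Finset.univ.image (g ∘ f), (Yᵀ *ᵥ x) j ^ 2 := by
      rw [Finset.sum_image hgf.injOn]
      simp [Matrix.mulVec, dotProduct, hN, sq]
    have h3 : ∑ j, (Yᵀ *ᵥ x) j ^ 2 = x ⬝ᵥ x := by
      have : (Yᵀ *ᵥ x) ⬝ᵥ (Yᵀ *ᵥ x) = x ⬝ᵥ ((Y * Yᵀ) *ᵥ x) := by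
        rw [← Matrix.mulVec_mulVec, Matrix.dotProduct_mulVec x, ← Matrix.mulVec_transpose]
      rw [hY, Matrix.one_mulVec] at this
      rw [← this, dotProduct]
      simp only [sq]
    have h4 := Finset.sum_sdiff (f := fun j => (Yᵀ *ᵥ x) j ^ 2) hsub
    have h5 := Finset.sum_add_sum_compl S fun j => (Yᵀ *ᵥ x) j ^ 2
    rw [fromCols_transpose_mulVec_dotProduct]
    linarith

end Selection

end SubsetSelection

/-! ### The selection theorem -/

theorem theorem3p1 (n m l : ℕ) (hn : 1 ≤ n)
    (Y : Matrix (Fin n) (Fin (m + l)) ℝ) (hY : Y * Yᵀ = 1)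
    (SM : Finset (Fin (m + l))) (hSM : SM.card = l)
    (k : ℕ) (hk₁ : (n : ℤ) - ((SubsetSelection.cols Y SM).rank : ℤ) ≤ (k : ℤ))
    (hk₂ : (k : ℤ) ≤ (m : ℤ) - 1) :
    ∃ S₀ : Finset (Fin (m + l)), Disjoint S₀ SM ∧ S₀.card = k ∧
      (SubsetSelection.Gam m n k (SubsetSelection.cols Y SM).rank)⁻¹ *
          (((m : ℝ) - n + (SubsetSelection.cols Y SM).rank) /
            ((m : ℝ) - n + ‖SubsetSelection.pinv (SubsetSelection.cols Y SM)‖ ^ 2)) ≤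
        SubsetSelection.sigmaMin
          (Matrix.fromCols (SubsetSelection.cols Y SM) (SubsetSelection.cols Y S₀)) ^ 2 := by
  have hk : n ≤ k + (SubsetSelection.cols Y SM).rank := by omega
  have hkm : k + 1 ≤ m := by omega
  have hrn : (SubsetSelection.cols Y SM).rank ≤ n := by
    simpa using Matrix.rank_le_card_height (SubsetSelection.cols Y SM)
  have hex := fun t (ht : (0 : ℝ) < t) =>
    SubsetSelection.exists_columns_le_sq_sigmaMin hn Y hY SM hSM hk hkm ht
  obtain ⟨hH, T₁, hT₁, -⟩ := hex 1 one_pos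
  -- The set obtained for each `t` depends on `t`. A maximizer among the finitely many candidates
  -- satisfies all these bounds at once, so limits in `t` are allowed.
  obtain ⟨S₀, hS₀, hmax⟩ := Finset.exists_max_image
    (Finset.univ.filter fun T : Finset (Fin (m + l)) => Disjoint T SM ∧ T.card = k)
    (fun T => SubsetSelection.sigmaMin
      (Matrix.fromCols (SubsetSelection.cols Y SM) (SubsetSelection.cols Y T)) ^ 2)
    ⟨T₁, Finset.mem_filter.mpr ⟨Finset.mem_univ _, hT₁⟩⟩
  have hS₀' := (Finset.mem_filter.mp hS₀).2
  refine ⟨S₀, hS₀'.1, hS₀'.2, ?_⟩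
  have hk' : (n : ℝ) ≤ k + (SubsetSelection.cols Y SM).rank := by exact_mod_cast hk
  have hkm' : (k : ℝ) + 1 ≤ m := by exact_mod_cast hkm
  have hrn' : ((SubsetSelection.cols Y SM).rank : ℝ) ≤ n := by exact_mod_cast hrn
  have hd : 0 < (m : ℝ) - n + (SubsetSelection.cols Y SM).rank := by linarith
  have key := SubsetSelection.optimize_barrier
    (a := (n : ℝ) - (SubsetSelection.cols Y SM).rank)
    (d := (m : ℝ) - n + (SubsetSelection.cols Y SM).rank) (B := (m : ℝ) - k - 1)
    (K := (k : ℝ) + 1) (by linarith) hd (by linarith) (div_pos hd hH) (by linarith) (by ring)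
    (fun t ht => by
      obtain ⟨-, T, hT, hle⟩ := hex t ht
      exact hle.trans (hmax T (Finset.mem_filter.mpr ⟨Finset.mem_univ _, hT⟩)))
  refine le_trans (le_of_eq ?_) key
  rw [SubsetSelection.Gam, inv_div]
  push_cast
  congr 3
  ring
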